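/- For all positive integers $l$, $m$, $n$, $r$ and any nonnegative integer $a$, the integer $$2\sum_{k=1}^{l} k^{2a+1}\binom{l+m}{l+k}^{r}\binom{m+n}{m+k}^{r}\binom{n+l}{n+k}^{r}$$ is divisible by each of the three integers $$\frac{lm}{\gcd(l,m)}\binom{l+m}{l},\qquad \frac{mn}{\gcd(m,n)}\binom{m+n}{m},\qquad \frac{nl}{\gcd(n,l)}\binom{n+l}{n},$$ where $\binom{N}{j}$ denotes the binomial coefficient, which is $0$ when $j>N$. -/

import Mathlib

/-! Up to factorials the summand is a product of terms `1/((x-k)!(x+k)!)`, with `x` running `r`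
times through `l, m, n`. Chu–Vandermonde expands the product of two such terms in single ones, so
merging the first two entries writes the normalised sum `chainSum` as a nonnegative integer
combination of sums for shorter lists. A single entry `x` leaves an odd moment of the row `2x` of
Pascal's triangle, divisible by `x * (2x choose x)`. Divisibility by both the first and the last
entry survives the merging, hence so does divisibility by their lcm; cyclic symmetry gives the three
claims. -/

/-! ### Odd moments of the central binomial row -/

open Finset in
theorem sum_two_mul_mul_choose (s K : ℕ) :
    ∑ k ∈ range K, 2 * (k : ℤ) * (2 * s).choose (s + k) =
      s * (2 * s).choose s - (s + K) * (2 * s).choose (s + K) := by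
  induction K with
  | zero => simp
  | succ K ih =>
    have h : ((2 * s).choose (s + K + 1) : ℤ) * (s + K + 1) =
        (2 * s).choose (s + K) * (s - K) := by
      rcases le_or_gt K s with hK | hK
      · have h1 := Nat.choose_succ_right_eq (2 * s) (s + K)
        have h2 : 2 * s - (s + K) = s - K := by omega
        rw [h2] at h1
        have h3 : ((s - K : ℕ) : ℤ) = (s : ℤ) - K := by omega
        rw [← h3]
        exact_mod_cast h1
      · rw [Nat.choose_eq_zero_of_lt (by omega), Nat.choose_eq_zero_of_lt (by omega)]
        simp
    rw [sum_range_succ, ih, ← add_assoc]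
    push_cast
    linear_combination h

theorem sq_sub_sq_mul_choose (t k : ℕ) :
    (((t : ℤ) + 1) ^ 2 - k ^ 2) * (2 * (t + 1)).choose (t + 1 + k) =
      (2 * (t + 1)) * (2 * t + 1) * (2 * t).choose (t + k) := by
  have h1 : ((2 * t + 2 : ℕ) : ℤ) * (2 * t + 1).choose (t + k) =
      (2 * t + 2).choose (t + k + 1) * (t + k + 1 : ℕ) := by
    exact_mod_cast Nat.add_one_mul_choose_eq (2 * t + 1) (t + k)
  have h2 : ((2 * t).choose (t + k) : ℤ) * (2 * t + 1) =
      (2 * t + 1).choose (t + k) * (t + 1 - k) := by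
    rcases le_or_gt k (t + 1) with hk | hk
    · have h := Nat.choose_mul_succ_eq (2 * t) (t + k)
      have h3 : 2 * t + 1 - (t + k) = t + 1 - k := by omega
      rw [h3] at h
      have h4 : ((t + 1 - k : ℕ) : ℤ) = (t : ℤ) + 1 - k := by omega
      rw [← h4]
      exact_mod_cast h
    · rw [Nat.choose_eq_zero_of_lt (by omega), Nat.choose_eq_zero_of_lt (by omega)]
      simp
  rw [show 2 * (t + 1) = 2 * t + 2 by ring, show t + 1 + k = t + k + 1 by ring]
  push_cast at h1
  linear_combination (-(t : ℤ) - 1 + k) * h1 - (2 * t + 2) * h2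

-- Induction on `a`: write `k^2 = s^2 - (s^2 - k^2)`. The factor `s^2 - k^2` turns row `2s` into row
-- `2(s-1)`, and `a = 0` telescopes.
open Finset in
theorem mul_centralBinom_dvd_sum (a s K : ℕ) (hs : s < K) :
    (s : ℤ) * (2 * s).choose s ∣
      ∑ k ∈ range K, 2 * (k : ℤ) ^ (2 * a + 1) * (2 * s).choose (s + k) := by
  induction a generalizing s with
  | zero =>
    have h := sum_two_mul_mul_choose s K
    rw [Nat.choose_eq_zero_of_lt (show 2 * s < s + K by omega)] at h
    simp only [mul_zero, zero_add, pow_one]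
    rw [h]
    simp
  | succ a ih =>
    cases s with
    | zero =>
      simp only [mul_zero, zero_add]
      rw [sum_eq_zero]
      · simp
      intro k _
      cases k <;> simp
    | succ t =>
      have hrec : ∑ k ∈ range K,
            2 * (k : ℤ) ^ (2 * (a + 1) + 1) * (2 * (t + 1)).choose (t + 1 + k) =
          ((t : ℤ) + 1) ^ 2 *
            (∑ k ∈ range K, 2 * (k : ℤ) ^ (2 * a + 1) * (2 * (t + 1)).choose (t + 1 + k)) -
          (2 * (t + 1)) * (2 * t + 1) *
            ∑ k ∈ range K, 2 * (k : ℤ) ^ (2 * a + 1) * (2 * t).choose (t + k) := by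
        rw [mul_sum, mul_sum, ← sum_sub_distrib]
        refine sum_congr rfl fun k _ => ?_
        linear_combination (-2 * (k : ℤ) ^ (2 * a + 1)) * sq_sub_sq_mul_choose t k
      rw [hrec]
      refine dvd_sub ((ih (t + 1) hs).mul_left _) ?_
      obtain ⟨c, hc⟩ := ih t (by omega)
      rw [hc]
      have h : ((t : ℤ) + 1) * (2 * (t + 1)).choose (t + 1) =
          2 * (2 * t + 1) * (2 * t).choose t := by
        have := Nat.succ_mul_centralBinom_succ t
        simp only [Nat.centralBinom_eq_two_mul_choose] at this
        exact_mod_cast this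
      push_cast
      rw [h]
      exact ⟨(t + 1) * t * c, by ring⟩

/-! ### Linearising products of reciprocal factorials -/

/-- The reciprocal of `(n - k)! * (n + k)!`, read as `0` when `k > n`. -/
noncomputable def invFactorialPair (n k : ℕ) : ℚ :=
  (2 * n).choose (n + k) / (2 * n).factorial

theorem invFactorialPair_of_lt {n k : ℕ} (h : n < k) : invFactorialPair n k = 0 := by
  simp [invFactorialPair, Nat.choose_eq_zero_of_lt (show 2 * n < n + k by omega)]

theorem invFactorialPair_add (k p : ℕ) :
    invFactorialPair (k + p) k = 1 / (p.factorial * (2 * k + p).factorial) := by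
  rw [invFactorialPair, Nat.cast_choose ℚ (by omega),
    show 2 * (k + p) - (k + p + k) = p by omega, show k + p + k = 2 * k + p by omega]
  have := Nat.factorial_ne_zero (2 * (k + p))
  field_simp

theorem choose_mul_factorial_mul_factorial_add (n h s : ℕ) :
    (n + h).choose (s + h) * (s + h).factorial * n.factorial =
      n.choose s * s.factorial * (n + h).factorial := by
  rcases le_or_gt s n with hs | hs
  · have h1 := Nat.choose_mul_factorial_mul_factorial hs
    have h2 := Nat.choose_mul_factorial_mul_factorial (show s + h ≤ n + h by omega)
    rw [show n + h - (s + h) = n - s by omega] at h2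
    rw [← h1, ← h2]
    ring
  · rw [Nat.choose_eq_zero_of_lt hs, Nat.choose_eq_zero_of_lt (show n + h < s + h by omega)]
    simp

open Finset in
theorem sum_choose_mul_choose (p q k : ℕ) :
    ∑ j ∈ range (p + 1), p.choose j * (q + 2 * k).choose (2 * k + j) =
      (p + q + 2 * k).choose (p + 2 * k) := by
  rw [add_assoc, Nat.add_choose_eq, Nat.sum_antidiagonal_eq_sum_range_succ_mk,
    show (p + 2 * k).succ = (p + 1) + 2 * k by omega, sum_range_add _ (p + 1) (2 * k),
    sum_eq_zero (s := range (2 * k)), add_zero, ← sum_range_reflect]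
  · refine sum_congr rfl fun j hj => ?_
    have hj : j ≤ p := by simpa [Nat.lt_succ_iff] using hj
    rw [show p + 1 - 1 - j = p - j by omega, Nat.choose_symm hj,
      show 2 * k + (p - j) = p + 2 * k - j by omega]
  · intro j _
    rw [Nat.choose_eq_zero_of_lt (by omega), zero_mul]

-- With `x = k + p`, `y = k + q`, `s = k + j`, clearing factorials leaves the Vandermonde sum
-- `sum_choose_mul_choose`.
open Finset in
theorem invFactorialPair_mul (x y k : ℕ) :
    (x.factorial * y.factorial * (x + y).factorial : ℚ) *
        (invFactorialPair x k * invFactorialPair y k) =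
      ∑ s ∈ range (x + 1), (x.choose s * y.choose s : ℚ) * s.factorial ^ 2 *
        invFactorialPair s k := by
  rcases lt_or_ge x k with hx | hx
  · rw [invFactorialPair_of_lt hx, sum_eq_zero]
    · simp
    intro s hs
    rw [invFactorialPair_of_lt (by simp at hs; omega), mul_zero]
  rcases lt_or_ge y k with hy | hy
  · rw [invFactorialPair_of_lt hy, sum_eq_zero]
    · simp
    intro s hs
    rcases lt_or_ge s k with h | h
    · rw [invFactorialPair_of_lt h, mul_zero]
    · rw [Nat.choose_eq_zero_of_lt (show y < s by omega)]
      simp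
  obtain ⟨p, rfl⟩ := Nat.exists_eq_add_of_le hx
  obtain ⟨q, rfl⟩ := Nat.exists_eq_add_of_le hy
  rw [add_assoc k p 1, sum_range_add, sum_eq_zero (s := range k), zero_add]
  swap
  · intro s hs
    rw [invFactorialPair_of_lt (by simpa using hs), mul_zero]
  have hterm : ∀ j ∈ range (p + 1),
      ((k + p).choose (k + j) * (k + q).choose (k + j) : ℚ) * (k + j).factorial ^ 2 *
        invFactorialPair (k + j) k =
      ((k + p).factorial * (k + q).factorial / (p.factorial * (q + 2 * k).factorial) : ℚ) *
        (p.choose j * (q + 2 * k).choose (2 * k + j) : ℕ) := by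
    intro j hj
    have h1 := choose_mul_factorial_mul_factorial_add p k j
    have h2 := choose_mul_factorial_mul_factorial_add q k j
    have h3 := choose_mul_factorial_mul_factorial_add q (2 * k) j
    rw [add_comm p k, add_comm j k] at h1
    rw [add_comm q k, add_comm j k] at h2
    rw [add_comm j] at h3
    rw [invFactorialPair_add]
    have f1 := Nat.cast_ne_zero (R := ℚ).2 (Nat.factorial_ne_zero p)
    have f2 := Nat.cast_ne_zero (R := ℚ).2 (Nat.factorial_ne_zero q)
    have f3 := Nat.cast_ne_zero (R := ℚ).2 (Nat.factorial_ne_zero (q + 2 * k))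
    have f4 := Nat.cast_ne_zero (R := ℚ).2 (Nat.factorial_ne_zero j)
    have f5 := Nat.cast_ne_zero (R := ℚ).2 (Nat.factorial_ne_zero (2 * k + j))
    have e1 : ((k + p).choose (k + j) * (k + j).factorial : ℚ) =
        p.choose j * j.factorial * (k + p).factorial / p.factorial := by
      rw [eq_div_iff f1]; exact_mod_cast h1
    have e2 : ((k + q).choose (k + j) * (k + j).factorial : ℚ) =
        q.choose j * j.factorial * (k + q).factorial / q.factorial := by
      rw [eq_div_iff f2]; exact_mod_cast h2
    have e3 : ((q + 2 * k).choose (2 * k + j) : ℚ) =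
        q.choose j * j.factorial * (q + 2 * k).factorial /
          (q.factorial * (2 * k + j).factorial) := by
      rw [eq_div_iff (by positivity)]
      have h3' : ((q + 2 * k).choose (2 * k + j) * (2 * k + j).factorial * q.factorial : ℚ) =
        q.choose j * j.factorial * (q + 2 * k).factorial := by exact_mod_cast h3
      linear_combination h3'
    calc _ = ((k + p).choose (k + j) * (k + j).factorial : ℚ) *
          ((k + q).choose (k + j) * (k + j).factorial) *
          (1 / (j.factorial * (2 * k + j).factorial)) := by ring
      _ = _ := by
        push_cast
        rw [e1, e2, e3]
        field_simp
  rw [sum_congr rfl hterm, ← mul_sum, ← Nat.cast_sum, sum_choose_mul_choose,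
    invFactorialPair_add, invFactorialPair_add, Nat.cast_choose ℚ (by omega),
    show p + q + 2 * k - (p + 2 * k) = q by omega, show k + p + (k + q) = p + q + 2 * k by ring,
    add_comm (2 * k) p, add_comm (2 * k) q]
  have f1 := Nat.cast_ne_zero (R := ℚ).2 (Nat.factorial_ne_zero (p + 2 * k))
  have f2 := Nat.cast_ne_zero (R := ℚ).2 (Nat.factorial_ne_zero (q + 2 * k))
  field_simp

/-! ### Merging along a chain -/

/-- The product of `invFactorialPair x k` over the entries `x` of a list, times the product of the
factorials of the sums of consecutive entries and of the factorial of the last entry. -/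
noncomputable def chainProd (k : ℕ) : List ℕ → ℚ
  | [] => 1
  | x :: L => invFactorialPair x k * (x + L.headI).factorial * chainProd k L

/-- The odd power moment of `chainProd`, scaled by the factorial of the head. -/
noncomputable def chainSum (a K : ℕ) (L : List ℕ) : ℚ :=
  L.headI.factorial * ∑ k ∈ Finset.range K, 2 * (k : ℚ) ^ (2 * a + 1) * chainProd k L

open Finset in
theorem chainSum_cons_cons (a K x y : ℕ) (L : List ℕ) :
    chainSum a K (x :: y :: L) = ∑ s ∈ range (x + 1),
      (x.choose s * (y + L.headI).choose (s + L.headI) : ℚ) * chainSum a K (s :: L) := by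
  simp only [chainSum, chainProd, List.headI_cons, mul_sum]
  rw [sum_comm]
  refine sum_congr rfl fun k _ => ?_
  have f1 := Nat.cast_ne_zero (R := ℚ).2 (Nat.factorial_ne_zero y)
  have h : ∀ s ∈ range (x + 1),
      (x.choose s * (y + L.headI).choose (s + L.headI) : ℚ) * (s.factorial *
        (2 * (k : ℚ) ^ (2 * a + 1) *
          (invFactorialPair s k * (s + L.headI).factorial * chainProd k L))) =
      (2 * (k : ℚ) ^ (2 * a + 1) * chainProd k L * (y + L.headI).factorial / y.factorial) *
        ((x.choose s * y.choose s : ℚ) * s.factorial ^ 2 * invFactorialPair s k) := by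
    intro s _
    have h1 : ((y + L.headI).choose (s + L.headI) * (s + L.headI).factorial : ℚ) =
        y.choose s * s.factorial * (y + L.headI).factorial / y.factorial := by
      rw [eq_div_iff f1]
      exact_mod_cast choose_mul_factorial_mul_factorial_add y L.headI s
    linear_combination (x.choose s * s.factorial * 2 * (k : ℚ) ^ (2 * a + 1) *
      invFactorialPair s k * chainProd k L) * h1
  rw [sum_congr rfl h, ← mul_sum, ← invFactorialPair_mul]
  field_simp

theorem chainSum_singleton (a K x : ℕ) (hx : x < K) :
    ∃ t : ℤ, chainSum a K [x] = x * t := by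
  obtain ⟨t, ht⟩ := mul_centralBinom_dvd_sum a x K hx
  refine ⟨t, ?_⟩
  have h : ∑ k ∈ Finset.range K, 2 * (k : ℚ) ^ (2 * a + 1) * (2 * x).choose (x + k) =
      x * (2 * x).choose x * t := by exact_mod_cast ht
  have h2 : ((2 * x).choose x * x.factorial * x.factorial : ℚ) = (2 * x).factorial := by
    have := Nat.choose_mul_factorial_mul_factorial (show x ≤ 2 * x by omega)
    rw [show 2 * x - x = x by omega] at this
    exact_mod_cast this
  have f := Nat.cast_ne_zero (R := ℚ).2 (Nat.factorial_ne_zero (2 * x))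
  have h3 : chainSum a K [x] = x.factorial * x.factorial / (2 * x).factorial *
      ∑ k ∈ Finset.range K, 2 * (k : ℚ) ^ (2 * a + 1) * (2 * x).choose (x + k) := by
    simp only [chainSum, chainProd, invFactorialPair, List.headI_cons, List.headI_nil, add_zero,
      Nat.default_eq_zero, Finset.mul_sum]
    refine Finset.sum_congr rfl fun k _ => ?_
    ring
  rw [h3, h, div_mul_eq_mul_div, div_eq_iff f, ← h2]
  ring

theorem exists_choose_mul_eq (x s : ℕ) : ∃ c : ℕ, (x.choose s * s : ℚ) = x * c := by
  cases s with
  | zero => exact ⟨0, by simp⟩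
  | succ s =>
    cases x with
    | zero => exact ⟨0, by simp⟩
    | succ x => exact ⟨x.choose s, by exact_mod_cast (Nat.add_one_mul_choose_eq x s).symm⟩

theorem exists_sum_eq_mul {ι : Type*} (S : Finset ι) (f : ι → ℚ) (d : ℚ)
    (h : ∀ i ∈ S, ∃ t : ℤ, f i = d * t) : ∃ t : ℤ, ∑ i ∈ S, f i = d * t := by
  choose! t ht using h
  refine ⟨∑ i ∈ S, t i, ?_⟩
  rw [Finset.sum_congr rfl ht, ← Finset.mul_sum]
  push_cast
  rfl

theorem chainSum_divisible (a K : ℕ) (L : List ℕ) (x : ℕ) (hx : x < K) :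
    (∃ t : ℤ, chainSum a K (x :: L) = x * t) ∧
      ∃ t : ℤ, chainSum a K (x :: L) = ((x :: L).getLast (List.cons_ne_nil x L) : ℕ) * t := by
  induction L generalizing x with
  | nil => exact ⟨chainSum_singleton a K x hx, chainSum_singleton a K x hx⟩
  | cons y L ih =>
    rw [chainSum_cons_cons]
    constructor <;> refine exists_sum_eq_mul _ _ _ fun s hs => ?_
    -- Head: absorption trades the factor `s` from the shorter chain for `x`.
    · obtain ⟨t, ht⟩ := (ih s (by simp at hs; omega)).1
      obtain ⟨c, hc⟩ := exists_choose_mul_eq x s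
      refine ⟨c * (y + L.headI).choose (s + L.headI) * t, ?_⟩
      rw [ht]
      push_cast
      linear_combination ((y + L.headI).choose (s + L.headI) * t : ℚ) * hc
    · obtain ⟨t, ht⟩ := (ih s (by simp at hs; omega)).2
      rw [ht]
      cases L with
      | nil =>
        -- Here `s` is also the last entry. As `[].headI = 0`, the second coefficient is `y.choose
        -- s`, which absorbs `s` into `y`.
        obtain ⟨c, hc⟩ := exists_choose_mul_eq y s
        refine ⟨x.choose s * c * t, ?_⟩
        simp only [List.getLast_singleton, List.headI_nil, Nat.default_eq_zero, add_zero,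
          List.getLast_cons_cons]
        push_cast
        linear_combination (x.choose s * t : ℚ) * hc
      | cons z L =>
        refine ⟨x.choose s * (y + z).choose (s + z) * t, ?_⟩
        simp only [List.getLast_cons_cons, List.headI_cons]
        push_cast
        ring

/-! ### The periodic chain and the three divisors -/

/-- The list consisting of `r + 1` copies of `l, m, n`. -/
def repeatTriple (l m n : ℕ) : ℕ → List ℕ
  | 0 => [l, m, n]
  | r + 1 => l :: m :: n :: repeatTriple l m n r

theorem repeatTriple_headI (l m n r : ℕ) : (repeatTriple l m n r).headI = l := by
  cases r <;> rfl

theorem repeatTriple_ne_nil (l m n r : ℕ) : repeatTriple l m n r ≠ [] := by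
  cases r <;> simp [repeatTriple]

theorem repeatTriple_getLast (l m n r : ℕ) :
    (repeatTriple l m n r).getLast (repeatTriple_ne_nil l m n r) = n := by
  induction r with
  | zero => simp [repeatTriple]
  | succ r ih => simpa [repeatTriple, List.getLast_cons, repeatTriple_ne_nil] using ih

theorem choose_mul_choose_mul_choose_eq (l m n k : ℕ) :
    ((l + m).choose (l + k) * (m + n).choose (m + k) * (n + l).choose (n + k) : ℚ) =
      (l + m).factorial * (m + n).factorial * (n + l).factorial *
        (invFactorialPair l k * invFactorialPair m k * invFactorialPair n k) := by
  rcases lt_or_ge l k with h | hl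
  · rw [invFactorialPair_of_lt h, Nat.choose_eq_zero_of_lt (show n + l < n + k by omega)]; simp
  rcases lt_or_ge m k with h | hm
  · rw [invFactorialPair_of_lt h, Nat.choose_eq_zero_of_lt (show l + m < l + k by omega)]; simp
  rcases lt_or_ge n k with h | hn
  · rw [invFactorialPair_of_lt h, Nat.choose_eq_zero_of_lt (show m + n < m + k by omega)]; simp
  obtain ⟨p, rfl⟩ := Nat.exists_eq_add_of_le hl
  obtain ⟨q, rfl⟩ := Nat.exists_eq_add_of_le hm
  obtain ⟨t, rfl⟩ := Nat.exists_eq_add_of_le hn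
  rw [Nat.cast_choose ℚ (by omega), Nat.cast_choose ℚ (by omega), Nat.cast_choose ℚ (by omega),
    invFactorialPair_add, invFactorialPair_add, invFactorialPair_add,
    show k + p + (k + q) - (k + p + k) = q by omega,
    show k + q + (k + t) - (k + q + k) = t by omega,
    show k + t + (k + p) - (k + t + k) = p by omega,
    show k + p + k = 2 * k + p by omega, show k + q + k = 2 * k + q by omega,
    show k + t + k = 2 * k + t by omega]
  field_simp

theorem chainProd_repeatTriple (l m n k r : ℕ) :
    (n + l).factorial * chainProd k (repeatTriple l m n r) = n.factorial *
      ((l + m).choose (l + k) * (m + n).choose (m + k) * (n + l).choose (n + k) : ℚ) ^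
        (r + 1) := by
  have h := choose_mul_choose_mul_choose_eq l m n k
  induction r with
  | zero =>
    simp only [repeatTriple, chainProd, List.headI_cons, List.headI_nil, Nat.default_eq_zero,
      add_zero, zero_add, pow_one]
    rw [h]
    ring
  | succ r ih =>
    rw [pow_succ, ← mul_assoc, ← ih, h]
    simp only [repeatTriple, chainProd, List.headI_cons, repeatTriple_headI]
    ring

theorem lcm_mul_choose_dvd_sum (l m n r a K : ℕ) (hl : l < K) :
    (n * l / Nat.gcd n l) * Nat.choose (n + l) n ∣
      2 * ∑ k ∈ Finset.range K, k ^ (2 * a + 1) *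
        ((l + m).choose (l + k) * (m + n).choose (m + k) * (n + l).choose (n + k)) ^ (r + 1) := by
  set S := 2 * ∑ k ∈ Finset.range K, k ^ (2 * a + 1) *
    ((l + m).choose (l + k) * (m + n).choose (m + k) * (n + l).choose (n + k)) ^ (r + 1) with hS
  have key : (∃ t : ℤ, chainSum a K (repeatTriple l m n r) = l * t) ∧
      ∃ t : ℤ, chainSum a K (repeatTriple l m n r) = n * t := by
    obtain ⟨L, hL⟩ : ∃ L, repeatTriple l m n r = l :: L := by cases r <;> exact ⟨_, rfl⟩
    have h := chainSum_divisible a K L l hl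
    have h2 := repeatTriple_getLast l m n r
    simp only [hL] at h2 ⊢
    rwa [h2] at h
  have hsum : (S : ℚ) = (n + l).choose n * chainSum a K (repeatTriple l m n r) := by
    have hc := Nat.choose_mul_factorial_mul_factorial (show n ≤ n + l by omega)
    rw [Nat.add_sub_cancel_left] at hc
    have hc' : ((n + l).choose n * n.factorial * l.factorial : ℚ) = (n + l).factorial := by
      exact_mod_cast hc
    have f := Nat.cast_ne_zero (R := ℚ).2 (Nat.factorial_ne_zero n)
    rw [hS, chainSum, repeatTriple_headI]
    push_cast
    simp only [Finset.mul_sum]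
    refine Finset.sum_congr rfl fun k _ => ?_
    have hk := chainProd_repeatTriple l m n k r
    apply mul_left_cancel₀ f
    linear_combination (-2 * (k : ℚ) ^ (2 * a + 1)) * hk -
      2 * (k : ℚ) ^ (2 * a + 1) * chainProd k (repeatTriple l m n r) * hc'
  obtain ⟨⟨t, ht⟩, ⟨u, hu⟩⟩ := key
  have htu : (l : ℤ) * t = n * u := by exact_mod_cast ht.symm.trans hu
  have hdvd : ((Nat.lcm n l : ℕ) : ℤ) ∣ l * t := by
    rw [Int.natCast_dvd]
    refine Nat.lcm_dvd ?_ ?_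
    · rw [htu, Int.natAbs_mul]; exact Dvd.intro _ rfl
    · rw [Int.natAbs_mul]; exact Dvd.intro _ rfl
  have hS' : (S : ℤ) = (l * t) * (n + l).choose n := by
    have : (S : ℚ) = (l * t) * (n + l).choose n := by rw [hsum, ht]; ring
    exact_mod_cast this
  rw [← Int.natCast_dvd_natCast, hS', Nat.cast_mul]
  exact mul_dvd_mul_right hdvd _

theorem corollary6p2 (l m n r : ℕ) (hl : 0 < l) (hm : 0 < m) (hn : 0 < n) (hr : 0 < r) (a : ℕ) :
    (l * m / Nat.gcd l m) * Nat.choose (l + m) l ∣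
        2 * ∑ k ∈ Finset.Icc 1 l, k ^ (2 * a + 1) *
          (Nat.choose (l + m) (l + k) ^ r * Nat.choose (m + n) (m + k) ^ r *
            Nat.choose (n + l) (n + k) ^ r) ∧
      (m * n / Nat.gcd m n) * Nat.choose (m + n) m ∣
        2 * ∑ k ∈ Finset.Icc 1 l, k ^ (2 * a + 1) *
          (Nat.choose (l + m) (l + k) ^ r * Nat.choose (m + n) (m + k) ^ r *
            Nat.choose (n + l) (n + k) ^ r) ∧
      (n * l / Nat.gcd n l) * Nat.choose (n + l) n ∣
        2 * ∑ k ∈ Finset.Icc 1 l, k ^ (2 * a + 1) *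
          (Nat.choose (l + m) (l + k) ^ r * Nat.choose (m + n) (m + k) ^ r *
            Nat.choose (n + l) (n + k) ^ r) := by
  obtain ⟨r, rfl⟩ : ∃ q, r = q + 1 := ⟨r - 1, by omega⟩
  -- A range symmetric in `l, m, n` serves all three rotations; the added terms vanish.
  have hsum : ∑ k ∈ Finset.Icc 1 l, k ^ (2 * a + 1) *
        ((l + m).choose (l + k) ^ (r + 1) * (m + n).choose (m + k) ^ (r + 1) *
          (n + l).choose (n + k) ^ (r + 1)) =
      ∑ k ∈ Finset.range (l + m + n + 1), k ^ (2 * a + 1) *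
        ((l + m).choose (l + k) * (m + n).choose (m + k) * (n + l).choose (n + k)) ^ (r + 1) := by
    simp only [← mul_pow]
    refine Finset.sum_subset (fun k hk => ?_) fun k _ hk => ?_
    · simp only [Finset.mem_Icc, Finset.mem_range] at hk ⊢
      omega
    · rcases Nat.eq_zero_or_pos k with rfl | hk0
      · simp
      · have : l < k := by simp only [Finset.mem_Icc] at hk; omega
        rw [Nat.choose_eq_zero_of_lt (show n + l < n + k by omega)]
        simp
  rw [hsum]
  refine ⟨?_, ?_, lcm_mul_choose_dvd_sum l m n r a _ (by omega)⟩
  · convert lcm_mul_choose_dvd_sum m n l r a (l + m + n + 1) (by omega) using 5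
    ring
  · convert lcm_mul_choose_dvd_sum n l m r a (l + m + n + 1) (by omega) using 5
    ring
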